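/- Let $B$ be the open unit ball of $\mathbb R^6$ centred at the origin, let $m\ge 2$ be an integer and $\bar\lambda>0$. Let $\bar u=\bar u^{m-1}$ be a classical radial solution of $$-\Delta \bar u=|\bar u|\,\bar u+\bar\lambda\,\bar u\ \text{ in } B,\qquad \bar u=0\ \text{ on }\partial B,\qquad \bar u(0)=\frac{\bar\lambda}{2},$$ which has exactly $m-1$ nodal zones (connected components of $\{x\in B:\bar u(x)\ne0\}$). Assume that $\bar u$ is nondegenerate, i.e. that $v\equiv 0$ is the only classical solution, radial or not, of $$-\Delta v=(2|\bar u|+\bar\lambda)\,v\ \text{ in } B,\qquad v=0\ \text{ on }\partial B,$$ and let $\bar v_0$ be a classical solution of $$-\Delta \bar v_0-(2|\bar u|+\bar\lambda)\,\bar v_0=\bar u\ \text{ in } B,\qquad \bar v_0=0\ \text{ on }\partial B.$$ Then $1-2\bar v_0(0)\neq 0$; and if $m=2$, then $1-2\bar v_0(0)>0$. (A classical solution is a function of class $C^2$ in $B$ and continuous on $\overline B$.) -/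

import Mathlib

open Metric

/-- Six-dimensional Euclidean space. -/
abbrev R6 : Type := EuclideanSpace ℝ (Fin 6)

/-- The regularity and boundary condition of a classical solution of a Dirichlet problem in the
open unit ball `B = ball 0 1` of `ℝ⁶`: of class `C²` in `B`, continuous up to the boundary and
zero on `∂B`. -/
structure IsC2Dirichlet (u : R6 → ℝ) : Prop where
  contDiffOn : ContDiffOn ℝ 2 u (ball 0 1)
  continuousOn : ContinuousOn u (closedBall 0 1)
  boundary : ∀ x ∈ sphere (0 : R6) 1, u x = 0

/-- `u` depends only on `|x|` in the closed unit ball. -/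
def IsRadialOnBall (u : R6 → ℝ) : Prop :=
  ∀ x ∈ closedBall (0 : R6) 1, ∀ y ∈ closedBall (0 : R6) 1, ‖x‖ = ‖y‖ → u x = u y

/-- The nodal zones of `u`: the connected components of `{x ∈ B | u x ≠ 0}`. -/
def nodalZones (u : R6 → ℝ) : Set (Set R6) :=
  {C | ∃ x ∈ {y ∈ ball (0 : R6) 1 | u y ≠ 0},
    C = connectedComponentIn {y ∈ ball (0 : R6) 1 | u y ≠ 0} x}

/-- `u` is a classical radial solution of
`-Δ u = |u| u + lam u` in `B`, `u = 0` on `∂B`, with `u 0 = lam / 2` and exactly `k` nodal zones. -/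
structure IsLimitProfile (lam : ℝ) (k : ℕ) (u : R6 → ℝ) : Prop where
  classical : IsC2Dirichlet u
  radial : IsRadialOnBall u
  equation : ∀ x ∈ ball (0 : R6) 1, -Laplacian.laplacian u x = |u x| * u x + lam * u x
  value_zero : u 0 = lam / 2
  nodal : (nodalZones u).encard = k

/-- `u` is nondegenerate: the linearized problem
`-Δ v = (2 |u| + lam) v` in `B`, `v = 0` on `∂B`, has only the zero solution
(among all functions, radial or not). -/
def IsNondegenerate (lam : ℝ) (u : R6 → ℝ) : Prop :=
  ∀ v : R6 → ℝ, IsC2Dirichlet v →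
    (∀ x ∈ ball (0 : R6) 1, -Laplacian.laplacian v x = (2 * |u x| + lam) * v x) →
    ∀ x ∈ ball (0 : R6) 1, v x = 0

/-- `v` is a classical solution of
`-Δ v - (2 |u| + lam) v = u` in `B`, `v = 0` on `∂B`. -/
structure IsLinearizedSolution (lam : ℝ) (u v : R6 → ℝ) : Prop where
  classical : IsC2Dirichlet v
  equation : ∀ x ∈ ball (0 : R6) 1,
    -Laplacian.laplacian v x - (2 * |u x| + lam) * v x = u x

open Set Filter Topology

/-! Nondegeneracy forces `v₀` to be radial, so everything reduces to ordinary differential equations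
on `(0, 1)`. Differentiating the scaling `t² u(t x)` at `t = 1` shows that `z = r u' + 2 u`
satisfies `-Δ z - (2|u| + lam) z = 2 lam u`. Hence `p = v₀ - z / (2 lam)` solves the homogeneous
linearized equation (`sub_dilation`). Since `u(0) = lam / 2`, its central value is `v₀(0) - 1/2`;
its boundary value is `-u'(1) / (2 lam)`.

If `p(0) = 0`, unique continuation from the centre (`eq_zero_of_center`) gives `p = 0`, hence `u'(1)
= 0`, which a Pohozaev-type monotone quantity excludes (`normalDeriv_ne_zero`).

If `m = 2`, then `u > 0`, `u` is largest at the centre, and `u'(1) < 0`, so `p(1) > 0`. Suppose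
`p(0) > 0`. The bound `u ≤ lam / 2` makes the linear potential at most `2 lam`, so comparison with
`u(√2 r)` keeps `p` positive for `r < 1/√2` (`linearized_pos_of_center_pos`). On the remaining
annulus the bound `lam < 32` (`lam_lt`) and an explicit positive supersolution give `p ≥ 0`
(`linearized_nonneg_of_annulus`). Testing the equation of `p` with `u` then contradicts `u'(1) p(1)
< 0` (`not_linearized_nonneg`). Thus `p(0) ≤ 0`, and strictly by the first part. -/

/-! ### Isometry invariance and radial symmetry. -/

/-- The Laplacian is invariant under linear isometries. -/
lemma laplacian_comp_linearIsometryEquiv (f : R6 → ℝ) (A : R6 ≃ₗᵢ[ℝ] R6) (x : R6) :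
    Laplacian.laplacian (f ∘ A) x = Laplacian.laplacian f (A x) := by
  rw [InnerProductSpace.laplacian_eq_iteratedFDeriv_orthonormalBasis (f ∘ A)
      (EuclideanSpace.basisFun (Fin 6) ℝ),
    InnerProductSpace.laplacian_eq_iteratedFDeriv_orthonormalBasis f
      ((EuclideanSpace.basisFun (Fin 6) ℝ).map A)]
  refine Finset.sum_congr rfl fun i _ => ?_
  have h := A.toContinuousLinearEquiv.iteratedFDerivWithin_comp_right (𝕜 := ℝ) f
    uniqueDiffOn_univ (x := x) (mem_univ _) 2
  simp only [preimage_univ, iteratedFDerivWithin_univ] at h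
  change iteratedFDeriv ℝ 2 (f ∘ A.toContinuousLinearEquiv) x _ = _
  rw [h, ContinuousMultilinearMap.compContinuousLinearMap_apply]
  congr 1
  ext j
  fin_cases j <;> rfl

/-- Composition with a linear isometry preserves `IsC2Dirichlet`. -/
lemma IsC2Dirichlet.comp_linearIsometryEquiv {f : R6 → ℝ} (hf : IsC2Dirichlet f)
    (A : R6 ≃ₗᵢ[ℝ] R6) : IsC2Dirichlet (f ∘ A) where
  contDiffOn := hf.contDiffOn.comp A.contDiff.contDiffOn fun x hx => by simpa using hx
  continuousOn := hf.continuousOn.comp A.continuous.continuousOn fun x hx => by simpa using hx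
  boundary x hx := hf.boundary (A x) (by simpa using hx)

lemma IsC2Dirichlet.sub {f g : R6 → ℝ} (hf : IsC2Dirichlet f) (hg : IsC2Dirichlet g) :
    IsC2Dirichlet (f - g) where
  contDiffOn := hf.contDiffOn.sub hg.contDiffOn
  continuousOn := hf.continuousOn.sub hg.continuousOn
  boundary x hx := by simp [hf.boundary x hx, hg.boundary x hx]

lemma IsC2Dirichlet.contDiffAt {f : R6 → ℝ} (hf : IsC2Dirichlet f) {x : R6}
    (hx : x ∈ ball (0 : R6) 1) : ContDiffAt ℝ 2 f x :=
  hf.contDiffOn.contDiffAt (isOpen_ball.mem_nhds hx)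

/-- If the linearized operator is nondegenerate, its solutions with radial data are radial. -/
lemma IsLinearizedSolution.isRadialOnBall {lam : ℝ} {u v : R6 → ℝ} (hu : IsRadialOnBall u)
    (hnd : IsNondegenerate lam u) (hv : IsLinearizedSolution lam u v) : IsRadialOnBall v := by
  intro x hx y hy hxy
  rcases (mem_closedBall_zero_iff.1 hx).lt_or_eq with hlt | heq
  -- This reflection swaps `x` and `y`. As `u` is invariant under it, `v ∘ A - v` solves the
  -- homogeneous problem and vanishes by nondegeneracy.
  · let A : R6 ≃ₗᵢ[ℝ] R6 := (ℝ ∙ (x - y))ᗮ.reflection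
    have hA : A x = y := Submodule.reflection_sub hxy
    have hvA := hv.classical.comp_linearIsometryEquiv A
    have := hnd _ (hvA.sub hv.classical) (fun z hz => ?_) x (mem_ball_zero_iff.2 hlt)
    · have h0 : v (A x) - v x = 0 := this
      rw [hA] at h0
      linarith
    · have hAz : A z ∈ ball (0 : R6) 1 := by simpa using hz
      have huA : u (A z) = u z :=
        hu _ (ball_subset_closedBall hAz) _ (ball_subset_closedBall hz) (A.norm_map z)
      rw [(hvA.contDiffAt hz).laplacian_sub (hv.classical.contDiffAt hz),
        laplacian_comp_linearIsometryEquiv]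
      have h1 := hv.equation _ hAz
      have h2 := hv.equation _ hz
      rw [huA] at h1
      simp only [Pi.sub_apply, Function.comp_apply]
      linarith
  · rw [hv.classical.boundary x (by simpa using heq),
      hv.classical.boundary y (by simpa [hxy] using heq)]

/-! ### Radial profiles and the polar form of the Laplacian. -/

/-- The unit vector along which radial profiles are taken. -/
noncomputable abbrev axisVector : R6 := EuclideanSpace.basisFun (Fin 6) ℝ 0

lemma norm_axisVector : ‖axisVector‖ = 1 := (EuclideanSpace.basisFun (Fin 6) ℝ).norm_eq_one 0

lemma norm_smul_axisVector (s : ℝ) : ‖s • axisVector‖ = |s| := by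
  rw [norm_smul, norm_axisVector, mul_one, Real.norm_eq_abs]

lemma smul_axisVector_mem_ball {s : ℝ} : s • axisVector ∈ ball (0 : R6) 1 ↔ |s| < 1 := by
  rw [mem_ball_zero_iff, norm_smul_axisVector]

lemma hasDerivAt_add_smul {E : Type*} [NormedAddCommGroup E] [NormedSpace ℝ E] (x e : E) (t : ℝ) :
    HasDerivAt (fun s : ℝ => x + s • e) e t := by
  simpa using ((hasDerivAt_id t).smul_const e).const_add x

lemma hasDerivAt_comp_line {E : Type*} [NormedAddCommGroup E] [NormedSpace ℝ E] {f : E → ℝ}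
    {x e : E} {t : ℝ}
    (hf : DifferentiableAt ℝ f (x + t • e)) :
    HasDerivAt (fun s : ℝ => f (x + s • e)) (fderiv ℝ f (x + t • e) e) t := by
  have h := hasDerivAt_add_smul x e t
  exact hf.hasFDerivAt.comp_hasDerivAt t h

lemma hasDerivAt_fderiv_comp_line {E : Type*} [NormedAddCommGroup E] [NormedSpace ℝ E]
    {f : E → ℝ} {x e : E} {t : ℝ}
    (hf : ContDiffAt ℝ 2 f (x + t • e)) :
    HasDerivAt (fun s : ℝ => fderiv ℝ f (x + s • e) e)
      (fderiv ℝ (fderiv ℝ f) (x + t • e) e e) t := by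
  have h := hasDerivAt_add_smul x e t
  have hd : DifferentiableAt ℝ (fderiv ℝ f) (x + t • e) :=
    (hf.fderiv_right (m := 1) one_add_one_eq_two.le).differentiableAt one_ne_zero
  exact (ContinuousLinearMap.apply ℝ ℝ e).hasFDerivAt.comp_hasDerivAt t
    (hd.hasFDerivAt.comp_hasDerivAt t h)

lemma laplacian_eq_sum_fderiv (f : R6 → ℝ) (x : R6) :
    Laplacian.laplacian f x = ∑ i, fderiv ℝ (fderiv ℝ f) x
      (EuclideanSpace.basisFun (Fin 6) ℝ i) (EuclideanSpace.basisFun (Fin 6) ℝ i) := by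
  rw [InnerProductSpace.laplacian_eq_iteratedFDeriv_orthonormalBasis f
    (EuclideanSpace.basisFun (Fin 6) ℝ)]
  simp [iteratedFDeriv_two_apply]

/-- The profile of `f` along the axis. -/
noncomputable def profile (f : R6 → ℝ) (s : ℝ) : ℝ := f (s • axisVector)

/-- The derivative of the profile of `f` along the axis. -/
noncomputable def profileDeriv (f : R6 → ℝ) (s : ℝ) : ℝ := fderiv ℝ f (s • axisVector) axisVector

lemma IsC2Dirichlet.hasDerivAt_profile {f : R6 → ℝ} (hf : IsC2Dirichlet f) {s : ℝ}
    (hs : |s| < 1) : HasDerivAt (profile f) (profileDeriv f s) s := by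
  have h := hasDerivAt_comp_line (f := f) (x := 0) (e := axisVector) (t := s)
    (by simpa only [zero_add] using
      (hf.contDiffAt (smul_axisVector_mem_ball.2 hs)).differentiableAt two_ne_zero)
  simp only [zero_add] at h
  exact h

/-- A tangential second derivative of a radial function. -/
lemma IsC2Dirichlet.fderiv_fderiv_tangential {f : R6 → ℝ} (hf : IsC2Dirichlet f)
    (hr : IsRadialOnBall f) {r : ℝ} (h0 : 0 < r) (h1 : r < 1) {e : R6} (he : ‖e‖ = 1)
    (hort : inner ℝ axisVector e = 0) :
    fderiv ℝ (fderiv ℝ f) (r • axisVector) e e = profileDeriv f r / r := by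
  have hrabs : |r| < 1 := by rwa [abs_of_pos h0]
  have hmem : r • axisVector + (0 : ℝ) • e ∈ ball (0 : R6) 1 := by
    simpa using smul_axisVector_mem_ball.2 hrabs
  have hA := hasDerivAt_fderiv_comp_line (hf.contDiffAt hmem)
  have hnorm : ∀ t : ℝ, ‖r • axisVector + t • e‖ = √(r ^ 2 + t ^ 2) := by
    intro t
    rw [eq_comm, Real.sqrt_eq_iff_mul_self_eq (by positivity) (norm_nonneg _),
      norm_add_mul_self_real, norm_smul_axisVector, norm_smul, he, inner_smul_left,
      inner_smul_right, hort]
    simp [← sq, sq_abs]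
  have hsq : ∀ t : ℝ, 0 < r ^ 2 + t ^ 2 := fun t => by positivity
  have hpos : ∀ t : ℝ, 0 < √(r ^ 2 + t ^ 2) := fun t => Real.sqrt_pos.2 (hsq t)
  have hsqrt : ∀ t : ℝ, HasDerivAt (fun t : ℝ => √(r ^ 2 + t ^ 2)) (t / √(r ^ 2 + t ^ 2)) t := by
    intro t
    have := ((hasDerivAt_pow 2 t).const_add (r ^ 2)).sqrt (hsq t).ne'
    convert this using 1
    rw [Nat.cast_ofNat, Nat.add_one_sub_one, pow_one, mul_div_mul_left _ _ two_ne_zero]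
  have hcont : Continuous (fun t : ℝ => √(r ^ 2 + t ^ 2)) := by fun_prop
  have hev : ∀ᶠ t : ℝ in 𝓝 0, √(r ^ 2 + t ^ 2) < 1 := by
    apply hcont.continuousAt.eventually_lt continuousAt_const
    simpa [Real.sqrt_sq h0.le] using h1
  have hball : ∀ t : ℝ, √(r ^ 2 + t ^ 2) < 1 → r • axisVector + t • e ∈ ball (0 : R6) 1 :=
    fun t ht => by rwa [mem_ball_zero_iff, hnorm]
  have hsabs : ∀ t : ℝ, √(r ^ 2 + t ^ 2) < 1 → |√(r ^ 2 + t ^ 2)| < 1 :=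
    fun t ht => by rwa [abs_of_pos (hpos t)]
  have hfeq : ∀ t : ℝ, √(r ^ 2 + t ^ 2) < 1 →
      f (r • axisVector + t • e) = profile f (√(r ^ 2 + t ^ 2)) := by
    intro t ht
    refine hr _ (ball_subset_closedBall (hball t ht)) _
      (ball_subset_closedBall (smul_axisVector_mem_ball.2 (hsabs t ht))) ?_
    rw [hnorm, norm_smul_axisVector, abs_of_pos (hpos t)]
  -- The first derivative along the tangent line has the form `t * K t`, so its derivative at `0` is
  -- `K 0`, the profile derivative divided by `r`.
  have hderiv : (fun t : ℝ => fderiv ℝ f (r • axisVector + t • e) e) =ᶠ[𝓝 0]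
      fun t => t * (profileDeriv f (√(r ^ 2 + t ^ 2)) / √(r ^ 2 + t ^ 2)) := by
    filter_upwards [hev.eventually_nhds] with t ht
    have htt := ht.self_of_nhds
    have d1 := hasDerivAt_comp_line (e := e)
      ((hf.contDiffAt (hball t htt)).differentiableAt two_ne_zero)
    have d2 : HasDerivAt (fun s : ℝ => profile f (√(r ^ 2 + s ^ 2)))
        (profileDeriv f (√(r ^ 2 + t ^ 2)) * (t / √(r ^ 2 + t ^ 2))) t :=
      HasDerivAt.comp (h₂ := profile f) t (hf.hasDerivAt_profile (hsabs t htt)) (hsqrt t)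
    have d3 := d2.congr_of_eventuallyEq (ht.mono fun s hs => hfeq s hs)
    rw [d1.unique d3]
    ring
  have hr0 : √(r ^ 2 + (0 : ℝ) ^ 2) = r := by simp [Real.sqrt_sq h0.le]
  have hp : DifferentiableAt ℝ (profileDeriv f) (√(r ^ 2 + (0 : ℝ) ^ 2)) := by
    rw [hr0]
    have := hasDerivAt_fderiv_comp_line (f := f) (x := 0) (e := axisVector) (t := r)
      (by simpa only [zero_add] using hf.contDiffAt (smul_axisVector_mem_ball.2 hrabs))
    simp only [zero_add] at this
    exact this.differentiableAt
  have hK : DifferentiableAt ℝ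
      (fun t : ℝ => profileDeriv f (√(r ^ 2 + t ^ 2)) / √(r ^ 2 + t ^ 2)) 0 :=
    (hp.comp (0 : ℝ) (hsqrt 0).differentiableAt).div (hsqrt 0).differentiableAt (hpos 0).ne'
  have hB := ((hasDerivAt_id (0 : ℝ)).mul hK.hasDerivAt).congr_of_eventuallyEq hderiv
  have := hA.unique hB
  rw [zero_smul, add_zero] at this
  rw [this]
  simp [Real.sqrt_sq h0.le]

/-- The radial form of the Laplacian in dimension six. -/
lemma IsC2Dirichlet.hasDerivAt_profileDeriv {f : R6 → ℝ} (hf : IsC2Dirichlet f)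
    (hr : IsRadialOnBall f) {r : ℝ} (h0 : 0 < r) (h1 : r < 1) :
    HasDerivAt (profileDeriv f)
      (-(5 / r) * profileDeriv f r + Laplacian.laplacian f (r • axisVector)) r := by
  have hrabs : |r| < 1 := by rwa [abs_of_pos h0]
  have h := hasDerivAt_fderiv_comp_line (f := f) (x := 0) (e := axisVector) (t := r)
    (by simpa only [zero_add] using hf.contDiffAt (smul_axisVector_mem_ball.2 hrabs))
  simp only [zero_add] at h
  change HasDerivAt (profileDeriv f) _ r at h
  have ht : ∀ i : Fin 5, fderiv ℝ (fderiv ℝ f) (r • axisVector)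
      (EuclideanSpace.basisFun (Fin 6) ℝ i.succ) (EuclideanSpace.basisFun (Fin 6) ℝ i.succ) =
        profileDeriv f r / r := fun i =>
    hf.fderiv_fderiv_tangential hr h0 h1 ((EuclideanSpace.basisFun (Fin 6) ℝ).norm_eq_one _)
      ((EuclideanSpace.basisFun (Fin 6) ℝ).inner_eq_zero (Fin.succ_ne_zero i).symm)
  have hΔ : Laplacian.laplacian f (r • axisVector) =
      fderiv ℝ (fderiv ℝ f) (r • axisVector) axisVector axisVector +
        5 * (profileDeriv f r / r) := by
    rw [laplacian_eq_sum_fderiv, Fin.sum_univ_succ, Finset.sum_congr rfl fun i _ => ht i,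
      Finset.sum_const, Finset.card_univ, Fintype.card_fin, nsmul_eq_mul, Nat.cast_ofNat]
  rw [hΔ]
  exact h.congr_deriv (by ring)

lemma IsC2Dirichlet.tendsto_profile_zero {f : R6 → ℝ} (hf : IsC2Dirichlet f) :
    Tendsto (profile f) (𝓝[>] 0) (𝓝 (f 0)) := by
  have := (hf.hasDerivAt_profile (s := 0) (by simp)).continuousAt.tendsto
  simp only [profile, zero_smul] at this
  exact this.mono_left nhdsWithin_le_nhds

/-- Radial symmetry makes the profile even, so its continuous derivative vanishes at the origin. -/
lemma IsC2Dirichlet.tendsto_profileDeriv_zero {f : R6 → ℝ} (hf : IsC2Dirichlet f)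
    (hr : IsRadialOnBall f) : Tendsto (profileDeriv f) (𝓝[>] 0) (𝓝 0) := by
  have h := hasDerivAt_fderiv_comp_line (f := f) (x := 0) (e := axisVector) (t := 0)
    (by simpa using hf.contDiffAt (x := 0) (by simp))
  simp only [zero_add] at h
  change HasDerivAt (profileDeriv f) _ 0 at h
  have hd := hf.hasDerivAt_profile (s := 0) (by simp)
  have hneg : HasDerivAt (fun s => profile f (-s)) (-profileDeriv f 0) 0 := by
    rw [← neg_zero (G := ℝ)] at hd
    simpa [Function.comp_def] using hd.comp (0 : ℝ) (hasDerivAt_neg 0)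
  have heq : (fun s => profile f (-s)) =ᶠ[𝓝 0] profile f := by
    filter_upwards [Ioo_mem_nhds (show (-1 : ℝ) < 0 by norm_num) one_pos] with s hs
    have : |s| ≤ 1 := abs_le.2 ⟨hs.1.le, hs.2.le⟩
    refine hr _ ?_ _ ?_ ?_ <;> simp only [mem_closedBall_zero_iff, norm_smul_axisVector, abs_neg]
      <;> assumption
  have hz : profileDeriv f 0 = 0 := by
    have := hd.unique (hneg.congr_of_eventuallyEq heq.symm)
    linarith
  have := h.continuousAt.tendsto
  rw [hz] at this
  exact this.mono_left nhdsWithin_le_nhds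

lemma IsC2Dirichlet.tendsto_profile_one {f : R6 → ℝ} (hf : IsC2Dirichlet f) :
    Tendsto (profile f) (𝓝[<] 1) (𝓝 0) := by
  have hmem : (1 : ℝ) • axisVector ∈ sphere (0 : R6) 1 := by
    simp
  have hc := hf.continuousOn _ (sphere_subset_closedBall hmem)
  rw [← hf.boundary _ hmem]
  refine hc.tendsto.comp (tendsto_nhdsWithin_iff.2 ⟨?_, ?_⟩)
  · exact ((continuous_id.smul continuous_const).tendsto _).mono_left nhdsWithin_le_nhds
  · filter_upwards [Ioo_mem_nhdsLT (show (0 : ℝ) < 1 by norm_num)] with s hs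
    rw [mem_closedBall_zero_iff, norm_smul_axisVector, abs_of_pos hs.1]
    exact hs.2.le

/-! ### Radial equations, monotonicity with one-sided limits, and Wronskians. -/

/-- `w` (with derivative `w'`) is a radial solution of `-Δ w = F` in the unit ball of `ℝ⁶`, with
value `a` at the centre and `b` on the boundary. -/
structure IsRadialSolution (F w w' : ℝ → ℝ) (a b : ℝ) : Prop where
  hasDerivAt : ∀ r ∈ Ioo (0 : ℝ) 1, HasDerivAt w (w' r) r
  hasDerivAt' : ∀ r ∈ Ioo (0 : ℝ) 1, HasDerivAt w' (-(5 / r) * w' r - F r) r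
  tendsto_zero : Tendsto w (𝓝[>] 0) (𝓝 a)
  tendsto_zero' : Tendsto w' (𝓝[>] 0) (𝓝 0)
  tendsto_one : Tendsto w (𝓝[<] 1) (𝓝 b)

lemma le_of_hasDerivAt_nonneg {a b A B : ℝ} {W W' : ℝ → ℝ}
    (hd : ∀ r ∈ Ioo a b, HasDerivAt W (W' r) r) (hW' : ∀ r ∈ Ioo a b, 0 ≤ W' r)
    (hA : Tendsto W (𝓝[>] a) (𝓝 A)) (hB : Tendsto W (𝓝[<] b) (𝓝 B)) :
    ∀ r ∈ Ioo a b, A ≤ W r ∧ W r ≤ B := by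
  have hm : MonotoneOn W (Ioo a b) := by
    apply monotoneOn_of_hasDerivWithinAt_nonneg (convex_Ioo a b) (f' := W')
    · exact fun r hr => (hd r hr).continuousAt.continuousWithinAt
    · exact fun r hr => (hd r (interior_subset hr)).hasDerivWithinAt
    · exact fun r hr => hW' r (interior_subset hr)
  intro r hr
  refine ⟨le_of_tendsto hA ?_, ge_of_tendsto hB ?_⟩
  · filter_upwards [Ioo_mem_nhdsGT hr.1] with s hs
    exact hm ⟨hs.1, hs.2.trans hr.2⟩ hr hs.2.le
  · filter_upwards [Ioo_mem_nhdsLT hr.2] with s hs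
    exact hm hr ⟨hr.1.trans hs.1, hs.2⟩ hs.1.le

lemma lt_of_hasDerivAt_pos {a b A B : ℝ} (hab : a < b) {W W' : ℝ → ℝ}
    (hd : ∀ r ∈ Ioo a b, HasDerivAt W (W' r) r) (hW' : ∀ r ∈ Ioo a b, 0 < W' r)
    (hA : Tendsto W (𝓝[>] a) (𝓝 A)) (hB : Tendsto W (𝓝[<] b) (𝓝 B)) : A < B := by
  have hm : StrictMonoOn W (Ioo a b) := by
    apply strictMonoOn_of_hasDerivWithinAt_pos (convex_Ioo a b) (f' := W')
    · exact fun r hr => (hd r hr).continuousAt.continuousWithinAt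
    · exact fun r hr => (hd r (interior_subset hr)).hasDerivWithinAt
    · exact fun r hr => hW' r (interior_subset hr)
  have hle := le_of_hasDerivAt_nonneg hd (fun r hr => (hW' r hr).le) hA hB
  obtain ⟨c, hc⟩ := exists_between hab
  obtain ⟨d, hd'⟩ := exists_between hc.2
  have hdm : d ∈ Ioo a b := ⟨hc.1.trans hd'.1, hd'.2⟩
  exact ((hle c hc).1.trans_lt (hm hc hdm hd'.1)).trans_le (hle d hdm).2

lemma exists_abs_le_of_tendsto {a b A B : ℝ} {w : ℝ → ℝ}
    (hw : ContinuousOn w (Ioo a b)) (hA : Tendsto w (𝓝[>] a) (𝓝 A))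
    (hB : Tendsto w (𝓝[<] b) (𝓝 B)) : ∃ K, ∀ r ∈ Ioo a b, |w r| ≤ K := by
  obtain ⟨K, hK⟩ := isCompact_Icc.exists_bound_of_continuousOn
    (continuousOn_Icc_extendFrom_Ioo hw hA hB)
  refine ⟨K, fun r hr => ?_⟩
  have := hK r (Ioo_subset_Icc_self hr)
  rwa [extendFrom_extends hw r hr] at this

/-- A bounded derivative makes `w` Lipschitz, and a Lipschitz function extends to the endpoint. -/
lemma exists_tendsto_of_hasDerivAt_bounded {a b K : ℝ} (hab : a < b) {w w' : ℝ → ℝ}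
    (hd : ∀ r ∈ Ioo a b, HasDerivAt w (w' r) r) (hK : ∀ r ∈ Ioo a b, |w' r| ≤ K) :
    ∃ L, Tendsto w (𝓝[<] b) (𝓝 L) := by
  have hK0 : 0 ≤ K := by
    obtain ⟨c, hc⟩ := exists_between hab
    exact (abs_nonneg _).trans (hK c hc)
  have hl : LipschitzOnWith ⟨K, hK0⟩ w (Ioo a b) :=
    (convex_Ioo a b).lipschitzOnWith_of_nnnorm_hasDerivWithin_le
      (fun r hr => (hd r hr).hasDerivWithinAt) fun r hr => hK r hr
  obtain ⟨g, hg, hgw⟩ := hl.extend_real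
  refine ⟨g b, ((hg.continuous.tendsto b).mono_left nhdsWithin_le_nhds).congr' ?_⟩
  filter_upwards [Ioo_mem_nhdsLT hab] with r hr using (hgw hr).symm

lemma hasDerivAt_abs_mul_self (x : ℝ) : HasDerivAt (fun x : ℝ => |x| * x) (2 * |x|) x := by
  rcases eq_or_ne x 0 with rfl | hx
  · rw [hasDerivAt_iff_isLittleO_nhds_zero]
    simp only [zero_add, abs_zero, mul_zero, smul_zero, sub_zero]
    have : (fun h : ℝ => |h|) =o[𝓝 0] (fun _ => (1 : ℝ)) := by
      rw [Asymptotics.isLittleO_one_iff]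
      simpa using (continuous_abs (G := ℝ)).tendsto 0
    simpa using this.mul_isBigO (Asymptotics.isBigO_refl (fun h : ℝ => h) (𝓝 0))
  · refine ((hasDerivAt_abs hx).mul (hasDerivAt_id x)).congr_deriv ?_
    simp only [id_eq, mul_one, sign_mul_self]
    ring

/-- Lagrange's identity for radial functions. -/
lemma hasDerivAt_wronskian {w w' y y' : ℝ → ℝ} {r F G : ℝ} (hr : r ≠ 0)
    (hw : HasDerivAt w (w' r) r) (hw' : HasDerivAt w' (-(5 / r) * w' r - F) r)
    (hy : HasDerivAt y (y' r) r) (hy' : HasDerivAt y' (-(5 / r) * y' r - G) r) :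
    HasDerivAt (fun r => r ^ 5 * (w r * y' r - w' r * y r)) (r ^ 5 * (F * y r - G * w r)) r := by
  refine ((hasDerivAt_pow 5 r).mul ((hw.mul hy').sub (hw'.mul hy))).congr_deriv ?_
  simp only [Pi.sub_apply, Pi.mul_apply]
  field_simp
  push_cast
  ring

/-- The derivative of a quotient in terms of the Wronskian. -/
lemma hasDerivAt_div_wronskian {w w' y y' : ℝ → ℝ} {r : ℝ} (hr : r ≠ 0)
    (hw : HasDerivAt w (w' r) r) (hy : HasDerivAt y (y' r) r) (hy0 : y r ≠ 0) :
    HasDerivAt (fun r => w r / y r)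
      (-(r ^ 5 * (w r * y' r - w' r * y r)) / (r ^ 5 * y r ^ 2)) r := by
  refine (hw.div hy hy0).congr_deriv ?_
  field_simp
  ring

/-! ### Flux, boundary derivatives and unique continuation. -/

namespace IsRadialSolution

variable {F w w' : ℝ → ℝ} {a b : ℝ}

lemma continuousOn (h : IsRadialSolution F w w' a b) : ContinuousOn w (Ioo 0 1) :=
  fun r hr => (h.hasDerivAt r hr).continuousAt.continuousWithinAt

lemma exists_abs_le (h : IsRadialSolution F w w' a b) : ∃ K, ∀ r ∈ Ioo (0 : ℝ) 1, |w r| ≤ K :=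
  exists_abs_le_of_tendsto h.continuousOn h.tendsto_zero h.tendsto_one

lemma hasDerivAt_flux (h : IsRadialSolution F w w' a b) {r : ℝ} (hr : r ∈ Ioo (0 : ℝ) 1) :
    HasDerivAt (fun r => r ^ 5 * w' r) (-(r ^ 5 * F r)) r := by
  have := hr.1.ne'
  refine ((hasDerivAt_pow 5 r).mul (h.hasDerivAt' r hr)).congr_deriv ?_
  field_simp
  push_cast
  ring

lemma tendsto_flux_zero (h : IsRadialSolution F w w' a b) :
    Tendsto (fun r => r ^ 5 * w' r) (𝓝[>] 0) (𝓝 0) := by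
  have h1 : Tendsto (fun r : ℝ => r ^ 5) (𝓝[>] 0) (𝓝 0) := by
    simpa using ((continuous_pow (M := ℝ) 5).tendsto 0).mono_left nhdsWithin_le_nhds
  simpa using h1.mul h.tendsto_zero'

/-- Classical solutions are only continuous up to the boundary; the normal derivative exists because
the flux `r ^ 5 * w'` has a bounded derivative. -/
lemma exists_tendsto_one' (h : IsRadialSolution F w w' a b) {K : ℝ}
    (hK : ∀ r ∈ Ioo (0 : ℝ) 1, |F r| ≤ K) : ∃ L, Tendsto w' (𝓝[<] 1) (𝓝 L) := by
  obtain ⟨L, hL⟩ := exists_tendsto_of_hasDerivAt_bounded (K := K) one_pos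
    (fun r hr => h.hasDerivAt_flux hr) fun r hr => by
      rw [abs_neg, abs_mul, abs_of_pos (pow_pos hr.1 5)]
      exact (mul_le_of_le_one_left (abs_nonneg _) (pow_le_one₀ hr.1.le hr.2.le)).trans (hK r hr)
  refine ⟨L / 1 ^ 5, (hL.div (((continuous_pow (M := ℝ) 5).tendsto 1).mono_left
    nhdsWithin_le_nhds) (by norm_num)).congr' ?_⟩
  filter_upwards [Ioo_mem_nhdsLT (zero_lt_one (α := ℝ))] with r hr
  exact mul_div_cancel_left₀ _ (pow_ne_zero 5 hr.1.ne')

/-- Unique continuation from the centre for linear radial equations. -/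
lemma eq_zero_of_center {Q : ℝ → ℝ} {K : ℝ} (h : IsRadialSolution (fun r => Q r * w r) w w' 0 b)
    (hK : ∀ r ∈ Ioo (0 : ℝ) 1, |Q r| ≤ K) : ∀ r ∈ Ioo (0 : ℝ) 1, w r = 0 := by
  -- Gronwall for the energy `w'² + w²`: the singular friction term only dissipates, and the cross
  -- term `2 (Q - 1) w w'` is at most `K + 1` times the energy, so the weighted energy decreases
  -- from `0`.
  have hd : ∀ r ∈ Ioo (0 : ℝ) 1, HasDerivAt
      (fun r => -(Real.exp (-(K + 1) * r) * (w' r * w' r + w r * w r)))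
      (Real.exp (-(K + 1) * r) * ((K + 1) * (w' r * w' r + w r * w r) +
        10 / r * (w' r * w' r) + 2 * (Q r - 1) * (w r * w' r))) r := by
    intro r hr
    have h1 := h.hasDerivAt r hr
    have h2 := h.hasDerivAt' r hr
    have he : HasDerivAt (fun r => Real.exp (-(K + 1) * r))
        (Real.exp (-(K + 1) * r) * -(K + 1)) r := by
      simpa using ((hasDerivAt_id r).const_mul (-(K + 1))).exp
    refine (he.mul ((h2.mul h2).add (h1.mul h1))).neg.congr_deriv ?_
    simp only [Pi.add_apply, Pi.mul_apply]
    have := hr.1.ne'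
    field_simp
    ring
  have hnn : ∀ r ∈ Ioo (0 : ℝ) 1, 0 ≤ Real.exp (-(K + 1) * r) *
      ((K + 1) * (w' r * w' r + w r * w r) +
        10 / r * (w' r * w' r) + 2 * (Q r - 1) * (w r * w' r)) := by
    intro r hr
    refine mul_nonneg (Real.exp_pos _).le ?_
    have h1 : 0 ≤ 10 / r * (w' r * w' r) :=
      mul_nonneg (div_nonneg (by norm_num) hr.1.le) (mul_self_nonneg _)
    obtain ⟨hq1, hq2⟩ := abs_le.1 (hK r hr)
    nlinarith [mul_nonneg (by linarith : (0 : ℝ) ≤ K - Q r + 2) (sq_nonneg (w' r - w r)),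
      mul_nonneg (by linarith : (0 : ℝ) ≤ K + Q r) (sq_nonneg (w' r + w r)),
      sq_nonneg (w' r - w r), sq_nonneg (w' r + w r)]
  have hlim : Tendsto (fun r => -(Real.exp (-(K + 1) * r) * (w' r * w' r + w r * w r)))
      (𝓝[>] 0) (𝓝 0) := by
    have he : Tendsto (fun r : ℝ => Real.exp (-(K + 1) * r)) (𝓝[>] 0)
        (𝓝 (Real.exp (-(K + 1) * 0))) :=
      ((by fun_prop : Continuous fun r : ℝ => Real.exp (-(K + 1) * r)).tendsto 0).mono_left
        nhdsWithin_le_nhds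
    simpa using (he.mul ((h.tendsto_zero'.mul h.tendsto_zero').add
      (h.tendsto_zero.mul h.tendsto_zero))).neg
  intro r hr
  obtain ⟨c, hc⟩ := exists_between hr.2
  have hsub : ∀ s ∈ Ioo (0 : ℝ) c, s ∈ Ioo (0 : ℝ) 1 := fun s hs => ⟨hs.1, hs.2.trans hc.2⟩
  have := (le_of_hasDerivAt_nonneg (fun s hs => hd s (hsub s hs))
    (fun s hs => hnn s (hsub s hs)) hlim
    ((hd c ⟨hr.1.trans hc.1, hc.2⟩).continuousAt.tendsto.mono_left nhdsWithin_le_nhds)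
    r ⟨hr.1, hc.1⟩).1
  have hE : w' r * w' r + w r * w r ≤ 0 :=
    nonpos_of_mul_nonpos_right (by linarith) (Real.exp_pos (-(K + 1) * r))
  exact mul_self_eq_zero.1 (le_antisymm (by linarith [mul_self_nonneg (w' r)])
    (mul_self_nonneg (w r)))

end IsRadialSolution

lemma tendsto_wronskian {w w' y y' : ℝ → ℝ} {s : Set ℝ} {x a a' c c' : ℝ}
    (hw : Tendsto w (𝓝[s] x) (𝓝 a)) (hw' : Tendsto w' (𝓝[s] x) (𝓝 a'))
    (hy : Tendsto y (𝓝[s] x) (𝓝 c)) (hy' : Tendsto y' (𝓝[s] x) (𝓝 c')) :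
    Tendsto (fun r => r ^ 5 * (w r * y' r - w' r * y r)) (𝓝[s] x)
      (𝓝 (x ^ 5 * (a * c' - a' * c))) :=
  (((continuous_pow (M := ℝ) 5).tendsto x).mono_left nhdsWithin_le_nhds).mul
    ((hw.mul hy').sub (hw'.mul hy))

/-! ### The nonlinear equation: Pohozaev identity and dilation. -/

/-- The right-hand side of the limit problem. -/
def emdenTerm (lam : ℝ) (u : ℝ → ℝ) (r : ℝ) : ℝ := |u r| * u r + lam * u r

lemma hasDerivAt_emdenTerm {lam : ℝ} {u u' : ℝ → ℝ} {r : ℝ} (h : HasDerivAt u (u' r) r) :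
    HasDerivAt (emdenTerm lam u) ((2 * |u r| + lam) * u' r) r := by
  refine (((hasDerivAt_abs_mul_self (u r)).comp r h).add (h.const_mul lam)).congr_deriv ?_
  ring

lemma tendsto_emdenTerm {lam a : ℝ} {u : ℝ → ℝ} {l : Filter ℝ} (h : Tendsto u l (𝓝 a)) :
    Tendsto (emdenTerm lam u) l (𝓝 (|a| * a + lam * a)) :=
  (h.abs.mul h).add (h.const_mul lam)

namespace IsRadialSolution

variable {lam : ℝ} {u u' : ℝ → ℝ} {b : ℝ}

lemma exists_tendsto_one'_emden {a c : ℝ}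
    (hu : IsRadialSolution (emdenTerm lam u) u u' a c) : ∃ b, Tendsto u' (𝓝[<] 1) (𝓝 b) := by
  obtain ⟨K, hK⟩ := exists_abs_le_of_tendsto
    (fun r hr => (hasDerivAt_emdenTerm (lam := lam)
      (hu.hasDerivAt r hr)).continuousAt.continuousWithinAt)
    (tendsto_emdenTerm hu.tendsto_zero) (tendsto_emdenTerm hu.tendsto_one)
  exact hu.exists_tendsto_one' hK

/-- A nontrivial radial solution has nonzero normal derivative on the boundary. -/
lemma normalDeriv_ne_zero (hlam : 0 < lam)
    (hu : IsRadialSolution (emdenTerm lam u) u u' (lam / 2) 0)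
    (hb : Tendsto u' (𝓝[<] 1) (𝓝 b)) : b ≠ 0 := by
  rintro rfl
  -- The weight `r ^ 10` cancels the friction term `-(5 / r) u'²` in the derivative of the energy.
  -- Only the nonnegative potential remains, whatever the sign of `u`; with `b = 0` the limit at `1`
  -- is `0`, which forces `u = 0`.
  have hd : ∀ r ∈ Ioo (0 : ℝ) 1, HasDerivAt
      (fun r => r ^ 10 * (u' r * u' r / 2 + (|u r| * u r * u r / 3 + lam * (u r * u r) / 2)))
      (r ^ 9 * (10 * (|u r| * u r * u r / 3 + lam * (u r * u r) / 2))) r := by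
    intro r hr
    have h1 := hu.hasDerivAt r hr
    have h2 := hu.hasDerivAt' r hr
    have h3 := (hasDerivAt_abs_mul_self (u r)).comp r h1
    have h4 := (((h2.mul h2).div_const 2).add
      (((h3.mul h1).div_const 3).add (((h1.mul h1).const_mul lam).div_const 2)))
    refine ((hasDerivAt_pow 10 r).mul h4).congr_deriv ?_
    have := hr.1.ne'
    simp only [Pi.add_apply, Pi.mul_apply, Function.comp_apply, emdenTerm]
    field_simp
    push_cast
    ring
  have hlim : ∀ {s : Set ℝ} {x c d : ℝ}, Tendsto u (𝓝[s] x) (𝓝 c) → Tendsto u' (𝓝[s] x) (𝓝 d) →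
      Tendsto (fun r => r ^ 10 * (u' r * u' r / 2 +
        (|u r| * u r * u r / 3 + lam * (u r * u r) / 2))) (𝓝[s] x)
        (𝓝 (x ^ 10 * (d * d / 2 + (|c| * c * c / 3 + lam * (c * c) / 2)))) := by
    intro s x c d hc hd
    exact (((continuous_pow (M := ℝ) 10).tendsto x).mono_left nhdsWithin_le_nhds).mul
      (((hd.mul hd).div_const 2).add ((((hc.abs.mul hc).mul hc).div_const 3).add
        (((hc.mul hc).const_mul lam).div_const 2)))
  have hpot : ∀ r, 0 ≤ |u r| * u r * u r := fun r => by
    rw [mul_assoc]; exact mul_nonneg (abs_nonneg _) (mul_self_nonneg _)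
  have hle := le_of_hasDerivAt_nonneg hd (fun r hr => mul_nonneg (pow_pos hr.1 9).le (by
      have := hpot r
      have := mul_nonneg hlam.le (mul_self_nonneg (u r))
      linarith)) (hlim hu.tendsto_zero hu.tendsto_zero') (hlim hu.tendsto_one hb)
  have hu0 : ∀ r ∈ Ioo (0 : ℝ) 1, u r = 0 := by
    intro r hr
    have h1 := nonpos_of_mul_nonpos_right ((hle r hr).2.trans_eq (by simp)) (pow_pos hr.1 10)
    have h2 := hpot r
    have h3 := mul_self_nonneg (u' r)
    have h4 : u r * u r ≤ 0 := nonpos_of_mul_nonpos_right (by linarith) hlam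
    exact mul_self_eq_zero.1 (le_antisymm h4 (mul_self_nonneg _))
  have h0 : Tendsto u (𝓝[>] 0) (𝓝 0) := tendsto_const_nhds.congr' (by
    filter_upwards [Ioo_mem_nhdsGT (zero_lt_one (α := ℝ))] with r hr using (hu0 r hr).symm)
  have := tendsto_nhds_unique h0 hu.tendsto_zero
  linarith

/-- The infinitesimal dilation `r u' + 2 u` turns a solution of the linearized problem with
right-hand side `u` into a solution of the homogeneous linearized equation. -/
lemma sub_dilation (hlam : 0 < lam) {v v' : ℝ → ℝ} {a : ℝ}
    (hu : IsRadialSolution (emdenTerm lam u) u u' (lam / 2) 0)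
    (hb : Tendsto u' (𝓝[<] 1) (𝓝 b))
    (hv : IsRadialSolution (fun r => (2 * |u r| + lam) * v r + u r) v v' a 0) :
    IsRadialSolution
      (fun r => (2 * |u r| + lam) * (v r - (r * u' r + 2 * u r) / (2 * lam)))
      (fun r => v r - (r * u' r + 2 * u r) / (2 * lam))
      (fun r => v' r - (-(2 * u' r) - r * emdenTerm lam u r) / (2 * lam))
      (a - 1 / 2) (-b / (2 * lam)) where
  -- The equation replaces `u''`: the derivative of `r u' + 2 u` is `-2 u' - r * emdenTerm`, with no
  -- second derivative left to differentiate.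
  hasDerivAt r hr := by
    refine ((hv.hasDerivAt r hr).sub ((((hasDerivAt_id r).mul (hu.hasDerivAt' r hr)).add
      ((hu.hasDerivAt r hr).const_mul 2)).div_const (2 * lam))).congr_deriv ?_
    have := hr.1.ne'
    simp only [id_eq]
    field_simp
    ring
  hasDerivAt' r hr := by
    refine ((hv.hasDerivAt' r hr).sub ((((hu.hasDerivAt' r hr).const_mul 2).neg.sub
      ((hasDerivAt_id r).mul (hasDerivAt_emdenTerm (hu.hasDerivAt r hr)))).div_const
        (2 * lam))).congr_deriv ?_
    have := hr.1.ne'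
    simp only [id_eq, emdenTerm]
    field_simp
    ring
  tendsto_zero := by
    have h := hv.tendsto_zero.sub ((((tendsto_id.mono_left nhdsWithin_le_nhds).mul
      hu.tendsto_zero').add (hu.tendsto_zero.const_mul 2)).div_const (2 * lam))
    -- The prescribed value `u(0) = lam / 2` is what produces the shift `1 / 2`.
    rw [show a - 1 / 2 = a - (0 * 0 + 2 * (lam / 2)) / (2 * lam) by field_simp; ring]
    exact h
  tendsto_zero' := by
    have h := hv.tendsto_zero'.sub ((((hu.tendsto_zero'.const_mul 2).neg.sub
      ((tendsto_id.mono_left nhdsWithin_le_nhds).mul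
      (tendsto_emdenTerm (lam := lam) hu.tendsto_zero))).div_const (2 * lam)))
    simpa using h
  tendsto_one := by
    have h := hv.tendsto_one.sub ((((tendsto_id.mono_left nhdsWithin_le_nhds).mul
      hb).add (hu.tendsto_one.const_mul 2)).div_const (2 * lam))
    rw [show -b / (2 * lam) = 0 - (1 * b + 2 * 0) / (2 * lam) by ring]
    exact h

lemma exists_linearized_bound {a c : ℝ} (hu : IsRadialSolution (emdenTerm lam u) u u' a c) :
    ∃ K, ∀ r ∈ Ioo (0 : ℝ) 1, |2 * |u r| + lam| ≤ K := by
  obtain ⟨K, hK⟩ := hu.exists_abs_le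
  refine ⟨2 * K + |lam|, fun r hr => (abs_add_le _ _).trans ?_⟩
  rw [abs_mul, abs_abs, abs_two]
  linarith [hK r hr]

/-! ### Nonnegative solutions: monotonicity, strict positivity and the bound on `lam`. -/

section Positive

variable (hlam : 0 < lam) (hu : IsRadialSolution (emdenTerm lam u) u u' (lam / 2) 0)
  (hb : Tendsto u' (𝓝[<] 1) (𝓝 b)) (hnn : ∀ r ∈ Ioo (0 : ℝ) 1, 0 ≤ u r)
include hlam hu hb hnn

lemma deriv_nonpos_of_nonneg {r : ℝ} (hr : r ∈ Ioo (0 : ℝ) 1) : u' r ≤ 0 := by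
  have h := (le_of_hasDerivAt_nonneg (fun r hr => (hu.hasDerivAt_flux hr).neg) (fun r hr => ?_)
    hu.tendsto_flux_zero.neg
    ((((continuous_pow (M := ℝ) 5).tendsto 1).mono_left nhdsWithin_le_nhds).mul hb).neg r hr).1
  · simp only [Pi.neg_apply, neg_zero, Left.nonneg_neg_iff] at h
    exact nonpos_of_mul_nonpos_right h (pow_pos hr.1 5)
  · have h0 := hnn r hr
    rw [neg_neg]
    exact mul_nonneg (pow_pos hr.1 5).le
      (add_nonneg (mul_nonneg (abs_nonneg _) h0) (mul_nonneg hlam.le h0))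

lemma antitoneOn_of_nonneg : AntitoneOn u (Ioo 0 1) := by
  apply antitoneOn_of_hasDerivWithinAt_nonpos (convex_Ioo 0 1) (f' := u') hu.continuousOn
  · exact fun r hr => (hu.hasDerivAt r (interior_subset hr)).hasDerivWithinAt
  · exact fun r hr => hu.deriv_nonpos_of_nonneg hlam hb hnn (interior_subset hr)

lemma le_center_of_nonneg {r : ℝ} (hr : r ∈ Ioo (0 : ℝ) 1) : u r ≤ lam / 2 := by
  refine ge_of_tendsto hu.tendsto_zero ?_
  filter_upwards [Ioo_mem_nhdsGT hr.1] with s hs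
  exact hu.antitoneOn_of_nonneg hlam hb hnn ⟨hs.1, hs.2.trans hr.2⟩ hr hs.2.le

lemma normalDeriv_neg : b < 0 := by
  refine lt_of_le_of_ne (le_of_tendsto hb ?_) (hu.normalDeriv_ne_zero hlam hb)
  filter_upwards [Ioo_mem_nhdsLT (zero_lt_one (α := ℝ))] with r hr
  exact hu.deriv_nonpos_of_nonneg hlam hb hnn hr

/-- By monotonicity an interior zero would persist up to the boundary and make the normal derivative
vanish. -/
lemma pos_of_nonneg {r : ℝ} (hr : r ∈ Ioo (0 : ℝ) 1) : 0 < u r := by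
  refine lt_of_le_of_ne (hnn r hr) fun h => ?_
  have hz : ∀ s ∈ Ioo r 1, u s = 0 := fun s hs =>
    le_antisymm ((hu.antitoneOn_of_nonneg hlam hb hnn hr ⟨hr.1.trans hs.1, hs.2⟩ hs.1.le).trans
      h.ge) (hnn s ⟨hr.1.trans hs.1, hs.2⟩)
  have hz' : ∀ s ∈ Ioo r 1, u' s = 0 := by
    intro s hs
    refine (hu.hasDerivAt s ⟨hr.1.trans hs.1, hs.2⟩).unique
      ((hasDerivAt_const s (0 : ℝ)).congr_of_eventuallyEq ?_)
    filter_upwards [Ioo_mem_nhds hs.1 hs.2] with t ht using hz t ht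
  refine hu.normalDeriv_ne_zero hlam hb (tendsto_nhds_unique hb
    (tendsto_const_nhds.congr' ?_))
  filter_upwards [Ioo_mem_nhdsLT hr.2] with s hs using (hz' s hs).symm

/-- An upper bound for `lam` from testing with `(1 - r²)²`. -/
lemma lam_lt : lam < 32 := by
  by_contra! h32
  -- The test function vanishes to second order at `r = 1`, so no boundary term survives. It
  -- satisfies `-Δ y = 24 - 32 r²` and `32 y + Δ y = 8 (1 - 2 r²)² ≥ 0`.
  have hy : ∀ r : ℝ, HasDerivAt (fun r : ℝ => (1 - r ^ 2) ^ 2) (-4 * r * (1 - r ^ 2)) r := by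
    intro r
    refine (((hasDerivAt_pow 2 r).const_sub 1).pow 2).congr_deriv ?_
    simp
    ring
  have hy' : ∀ r ∈ Ioo (0 : ℝ) 1, HasDerivAt (fun r : ℝ => -4 * r * (1 - r ^ 2))
      (-(5 / r) * (-4 * r * (1 - r ^ 2)) - (24 - 32 * r ^ 2)) r := by
    intro r hr
    have := hr.1.ne'
    refine (((hasDerivAt_id r).const_mul (-4)).mul
      ((hasDerivAt_pow 2 r).const_sub 1)).congr_deriv ?_
    simp
    field_simp
    ring
  have hcont : ∀ (s : Set ℝ) (x : ℝ), Tendsto (fun r : ℝ => (1 - r ^ 2) ^ 2) (𝓝[s] x)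
      (𝓝 ((1 - x ^ 2) ^ 2)) := fun s x =>
    ((by fun_prop : Continuous fun r : ℝ => (1 - r ^ 2) ^ 2).tendsto x).mono_left nhdsWithin_le_nhds
  have hcont' : ∀ (s : Set ℝ) (x : ℝ), Tendsto (fun r : ℝ => -4 * r * (1 - r ^ 2)) (𝓝[s] x)
      (𝓝 (-4 * x * (1 - x ^ 2))) := fun s x =>
    ((by fun_prop : Continuous fun r : ℝ => -4 * r * (1 - r ^ 2)).tendsto x).mono_left
      nhdsWithin_le_nhds
  have := lt_of_hasDerivAt_pos one_pos
    (fun r hr => hasDerivAt_wronskian hr.1.ne' (hu.hasDerivAt r hr) (hu.hasDerivAt' r hr)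
      (hy r) (hy' r hr)) (fun r hr => ?_)
    (tendsto_wronskian hu.tendsto_zero hu.tendsto_zero' (hcont _ _) (hcont' _ _))
    (tendsto_wronskian hu.tendsto_one hb (hcont _ _) (hcont' _ _))
  · simp at this
  · have hp := hu.pos_of_nonneg hlam hb hnn hr
    have h1 : 0 < 1 - r ^ 2 := by nlinarith [hr.1, hr.2]
    have h2 : 0 < u r * (1 - r ^ 2) ^ 2 := by positivity
    have h3 : 32 * (1 - r ^ 2) ^ 2 ≤ lam * (1 - r ^ 2) ^ 2 := by gcongr
    have h4 : 0 < u r * (1 - r ^ 2) ^ 2 + lam * (1 - r ^ 2) ^ 2 - (24 - 32 * r ^ 2) := by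
      nlinarith [sq_nonneg (1 - 2 * r ^ 2)]
    rw [emdenTerm, abs_of_pos hp]
    refine mul_pos (pow_pos hr.1 5) ?_
    have := mul_pos hp h4
    linarith

end Positive

end IsRadialSolution

/-! ### Sign of radial solutions of the linearized equation. -/

namespace IsRadialSolution

variable {lam : ℝ} {u u' p p' : ℝ → ℝ} {a b c : ℝ}

/-- Comparison with the dilated solution `u (√2 r)`: a solution of the linearized equation that
is positive at the centre is positive on the ball of radius `1 / √2`. -/
lemma linearized_pos_of_center_pos
    (hu : IsRadialSolution (emdenTerm lam u) u u' (lam / 2) 0)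
    (hpos : ∀ r ∈ Ioo (0 : ℝ) 1, 0 < u r) (hle : ∀ r ∈ Ioo (0 : ℝ) 1, u r ≤ lam / 2)
    (hp : IsRadialSolution (fun r => (2 * |u r| + lam) * p r) p p' a c) (ha : 0 < a)
    {r : ℝ} (hr : 0 < r) (hr2 : √2 * r < 1) : 0 < p r := by
  by_contra! hpr
  have h2 : (1 : ℝ) < √2 := by rw [Real.lt_sqrt] <;> norm_num
  have hsq : √2 * √2 = (2 : ℝ) := Real.mul_self_sqrt (by norm_num)
  have hin : ∀ s, 0 < s → s ≤ r → s ∈ Ioo (0 : ℝ) 1 ∧ √2 * s ∈ Ioo (0 : ℝ) 1 := by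
    intro s hs hsr
    have h3 : √2 * s < 1 := (mul_le_mul_of_nonneg_left hsr (by positivity)).trans_lt hr2
    exact ⟨⟨hs, by nlinarith⟩, by positivity, h3⟩
  obtain ⟨δ, hδ0, hδ⟩ := (mem_nhdsGT_iff_exists_Ioo_subset).1
    (hp.tendsto_zero.eventually (lt_mem_nhds ha))
  obtain ⟨d, hd0, hdlt⟩ := exists_between (lt_min hδ0 hr)
  have hdδ : d < δ := hdlt.trans_le (min_le_left _ _)
  have hdr : d < r := hdlt.trans_le (min_le_right _ _)
  have hcont : ContinuousOn p (Icc d r) :=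
    hp.continuousOn.mono fun s hs => (hin s (hd0.trans_le hs.1) hs.2).1
  -- `z` is the first point where `p ≤ 0`; starting at `d > 0` avoids the singular centre.
  obtain ⟨z, ⟨hzmem, hpz⟩, hzle⟩ := (isCompact_Icc.of_isClosed_subset
    (hcont.preimage_isClosed_of_isClosed isClosed_Icc isClosed_Iic) inter_subset_left).exists_isLeast
    ⟨r, ⟨hdr.le, le_rfl⟩, hpr⟩
  have hz0 : 0 < z := hd0.trans_le hzmem.1
  have hpd : ∀ s ∈ Ioo 0 δ, 0 < p s := fun s hs => hδ hs
  have hpz' : ∀ s ∈ Ioo 0 z, 0 < p s := by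
    intro s hs
    by_contra! hps
    rcases lt_or_ge s δ with h | h
    · exact (hpd s ⟨hs.1, h⟩).not_ge hps
    · exact (hzle ⟨⟨hdδ.le.trans h, hs.2.le.trans hzmem.2⟩, hps⟩).not_gt hs.2
  have hdz : d < z := lt_of_le_of_ne hzmem.1 fun h => (hpd d ⟨hd0, hdδ⟩).not_ge (h ▸ hpz)
  have hy : ∀ s, 0 < s → s ≤ r → HasDerivAt (fun s => u (√2 * s)) (√2 * u' (√2 * s)) s := by
    intro s hs hsr
    refine ((hu.hasDerivAt _ (hin s hs hsr).2).comp s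
      ((hasDerivAt_id s).const_mul √2)).congr_deriv ?_
    ring
  have hy' : ∀ s, 0 < s → s ≤ r → HasDerivAt (fun s => √2 * u' (√2 * s))
      (-(5 / s) * (√2 * u' (√2 * s)) - 2 * emdenTerm lam u (√2 * s)) s := by
    intro s hs hsr
    refine (((hu.hasDerivAt' _ (hin s hs hsr).2).comp s
      ((hasDerivAt_id s).const_mul √2)).const_mul √2).congr_deriv ?_
    have := hs.ne'
    have := (zero_lt_one.trans h2).ne'
    have h5 : 5 / (√2 * s) * √2 = 5 / s := by field_simp
    linear_combination (-(√2 * u' (√2 * s))) * h5 - emdenTerm lam u (√2 * s) * hsq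
  -- The dilated function has potential `2 u(√2 s) + 2 lam`, which dominates `2 u(s) + lam` because
  -- `u ≤ lam / 2`. Hence the Wronskian decreases from `0`, and `p / u(√2 ·)` increases up to `z`.
  have hW : ∀ s ∈ Ioo 0 z, s ^ 5 * (p s * (√2 * u' (√2 * s)) - p' s * u (√2 * s)) ≤ 0 := by
    have hd : ∀ s ∈ Ioc 0 z, HasDerivAt _ _ s := fun s hs =>
      (hasDerivAt_wronskian hs.1.ne' (hp.hasDerivAt s (hin s hs.1 (hs.2.trans hzmem.2)).1)
        (hp.hasDerivAt' s (hin s hs.1 (hs.2.trans hzmem.2)).1) (hy s hs.1 (hs.2.trans hzmem.2))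
        (hy' s hs.1 (hs.2.trans hzmem.2))).neg
    have hs0 : Tendsto (fun s : ℝ => √2 * s) (𝓝[>] 0) (𝓝[>] 0) := by
      refine tendsto_nhdsWithin_iff.2 ⟨?_, ?_⟩
      · simpa using ((continuous_const_mul √2).tendsto 0).mono_left nhdsWithin_le_nhds
      · filter_upwards [self_mem_nhdsWithin] with s hs
        exact mul_pos (zero_lt_one.trans h2) hs
    intro s hs
    have := (le_of_hasDerivAt_nonneg (fun s hs => hd s ⟨hs.1, hs.2.le⟩) (fun s hs => ?_)
      (tendsto_wronskian hp.tendsto_zero hp.tendsto_zero' (hu.tendsto_zero.comp hs0)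
        ((hu.tendsto_zero'.comp hs0).const_mul √2)).neg
      ((hd z ⟨hz0, le_rfl⟩).continuousAt.tendsto.mono_left nhdsWithin_le_nhds) s hs).1
    · simpa using this
    · obtain ⟨h3, h4⟩ := hin s hs.1 (hs.2.le.trans hzmem.2)
      have h5 := hpos _ h3
      have h6 := hpos _ h4
      rw [emdenTerm, abs_of_pos h5, abs_of_pos h6, ← mul_neg]
      refine mul_nonneg (pow_pos hs.1 5).le ?_
      have h7 := mul_nonneg (mul_pos (hpz' s hs) h6).le
        (by linarith [hle _ h3] : 0 ≤ lam + 2 * u (√2 * s) - 2 * u s)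
      linarith
  have hq : MonotoneOn (fun s => p s / u (√2 * s)) (Icc d z) := by
    have hdq : ∀ s ∈ Icc d z, HasDerivAt (fun s => p s / u (√2 * s)) _ s := fun s hs =>
      hasDerivAt_div_wronskian (y' := fun s => √2 * u' (√2 * s)) (hd0.trans_le hs.1).ne'
        (hp.hasDerivAt s (hin s (hd0.trans_le hs.1) (hs.2.trans hzmem.2)).1)
        (hy s (hd0.trans_le hs.1) (hs.2.trans hzmem.2))
        (hpos _ (hin s (hd0.trans_le hs.1) (hs.2.trans hzmem.2)).2).ne'
    apply monotoneOn_of_hasDerivWithinAt_nonneg (convex_Icc d z)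
    · exact fun s hs => (hdq s hs).continuousAt.continuousWithinAt
    · exact fun s hs => (hdq s (interior_subset hs)).hasDerivWithinAt
    · intro s hs
      rw [interior_Icc] at hs
      have hs0 := hd0.trans hs.1
      exact div_nonneg (neg_nonneg.2 (hW s ⟨hs0, hs.2⟩)) (by positivity)
  have h3 : 0 < p d / u (√2 * d) :=
    div_pos (hpd d ⟨hd0, hdδ⟩) (hpos _ (hin d hd0 hdr.le).2)
  have h4 : p z / u (√2 * z) ≤ 0 :=
    div_nonpos_of_nonpos_of_nonneg hpz (hpos _ (hin z hz0 hzmem.2).2).le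
  exact (h3.trans_le (hq ⟨le_rfl, hdz.le⟩ ⟨hdz.le, le_rfl⟩ hdz.le)).not_ge h4

/-- The outer annulus `1 / √2 < r < 1` is too thin for a solution of the linearized equation to
become negative inside it. -/
lemma linearized_nonneg_of_annulus (hlam' : lam < 32)
    (hpos : ∀ r ∈ Ioo (0 : ℝ) 1, 0 < u r) (hle : ∀ r ∈ Ioo (0 : ℝ) 1, u r ≤ lam / 2)
    (hp : IsRadialSolution (fun r => (2 * |u r| + lam) * p r) p p' a c) (hc : 0 < c)
    {r₀ : ℝ} (hr0 : 0 < r₀) (hr0sq : r₀ ^ 2 = 1 / 2) (hpr0 : 0 ≤ p r₀)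
    {r : ℝ} (hr : r ∈ Ioo r₀ 1) : 0 ≤ p r := by
  by_contra! hpr
  -- In dimension six `1` and `s⁻⁴` are harmonic and `-Δ s⁻² = 4 s⁻⁴`, so this function satisfies
  -- `-Δ y = 6 s⁻⁴`. Multiplied by `s⁴` it equals `(s² - 1/2)(1 - s²) + 1/32`, positive on the
  -- closed annulus.
  have hy : ∀ s : ℝ, 0 < s → HasDerivAt
      (fun s : ℝ => 3 / 2 * (s ^ 2)⁻¹ - 1 - 15 / 32 * (s ^ 4)⁻¹)
      (-3 * (s ^ 3)⁻¹ + 15 / 8 * (s ^ 5)⁻¹) s := by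
    intro s hs
    have := hs.ne'
    refine (((((hasDerivAt_pow 2 s).inv (by positivity)).const_mul (3 / 2)).sub_const 1).sub
      (((hasDerivAt_pow 4 s).inv (by positivity)).const_mul (15 / 32))).congr_deriv ?_
    field_simp
    push_cast
    ring
  have hy' : ∀ s : ℝ, 0 < s → HasDerivAt
      (fun s : ℝ => -3 * (s ^ 3)⁻¹ + 15 / 8 * (s ^ 5)⁻¹)
      (-(5 / s) * (-3 * (s ^ 3)⁻¹ + 15 / 8 * (s ^ 5)⁻¹) - 6 * (s ^ 4)⁻¹) s := by
    intro s hs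
    have := hs.ne'
    refine ((((hasDerivAt_pow 3 s).inv (by positivity)).const_mul (-3)).add
      (((hasDerivAt_pow 5 s).inv (by positivity)).const_mul (15 / 8))).congr_deriv ?_
    field_simp
    push_cast
    ring
  have hypos : ∀ s : ℝ, 0 < s → r₀ ≤ s → s ≤ 1 →
      0 < 3 / 2 * (s ^ 2)⁻¹ - 1 - 15 / 32 * (s ^ 4)⁻¹ := by
    intro s hs h1 h2
    have h3 : 1 / 2 ≤ s ^ 2 := hr0sq ▸ pow_le_pow_left₀ hr0.le h1 2
    have h4 : s ^ 2 ≤ 1 := pow_le_one₀ hs.le h2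
    have h5 : 3 / 2 * (s ^ 2)⁻¹ - 1 - 15 / 32 * (s ^ 4)⁻¹ =
        (3 / 2 * s ^ 2 - s ^ 4 - 15 / 32) / s ^ 4 := by field_simp
    rw [h5]
    apply div_pos _ (by positivity)
    nlinarith [mul_nonneg (sub_nonneg.2 h3) (sub_nonneg.2 h4)]
  obtain ⟨δ, hδ1, hδ⟩ := (mem_nhdsLT_iff_exists_Ioo_subset).1
    (hp.tendsto_one.eventually (lt_mem_nhds hc))
  obtain ⟨e, hemax, he1⟩ := exists_between (max_lt hδ1 hr.2)
  have hpe : 0 < p e := hδ ⟨(le_max_left _ _).trans_lt hemax, he1⟩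
  have hre : r < e := (le_max_right _ _).trans_lt hemax
  have hin : ∀ s ∈ Icc r₀ e, 0 < s ∧ s ∈ Ioo (0 : ℝ) 1 := fun s hs =>
    ⟨hr0.trans_le hs.1, hr0.trans_le hs.1, hs.2.trans_lt he1⟩
  have hdq : ∀ s ∈ Icc r₀ e, HasDerivAt
      (fun s => p s / (3 / 2 * (s ^ 2)⁻¹ - 1 - 15 / 32 * (s ^ 4)⁻¹)) _ s := fun s hs =>
    hasDerivAt_div_wronskian (y' := fun s => -3 * (s ^ 3)⁻¹ + 15 / 8 * (s ^ 5)⁻¹)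
      (hin s hs).1.ne' (hp.hasDerivAt s (hin s hs).2) (hy s (hin s hs).1)
      (hypos s (hin s hs).1 hs.1 (hs.2.trans he1.le)).ne'
  -- Maximum principle for the quotient: a negative minimum must be interior, so the Wronskian
  -- vanishes there. Just to the right it becomes positive, which makes the quotient decrease
  -- strictly below its minimum.
  obtain ⟨z, hz, hzmin⟩ := isCompact_Icc.exists_isMinOn ⟨r, hr.1.le, hre.le⟩
    fun s hs => (hdq s hs).continuousAt.continuousWithinAt
  have hzneg : p z / (3 / 2 * (z ^ 2)⁻¹ - 1 - 15 / 32 * (z ^ 4)⁻¹) < 0 :=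
    (hzmin ⟨hr.1.le, hre.le⟩).trans_lt
      (div_neg_of_neg_of_pos hpr (hypos r (hr0.trans hr.1) hr.1.le hr.2.le))
  have hpz : p z < 0 := by
    by_contra! h
    exact hzneg.not_ge (div_nonneg h (hypos z (hin z hz).1 hz.1 (hz.2.trans he1.le)).le)
  have hzr : r₀ < z := lt_of_le_of_ne hz.1 fun h => (h ▸ hpz).not_ge hpr0
  have hze : z < e := lt_of_le_of_ne hz.2 fun h => (h ▸ hpz).not_gt hpe
  have hz0 : 0 < z := (hin z hz).1
  have hloc := (hzmin.isLocalMin (Icc_mem_nhds hzr hze)).hasDerivAt_eq_zero (hdq z hz)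
  have hWz : z ^ 5 * (p z * (-3 * (z ^ 3)⁻¹ + 15 / 8 * (z ^ 5)⁻¹) -
      p' z * (3 / 2 * (z ^ 2)⁻¹ - 1 - 15 / 32 * (z ^ 4)⁻¹)) = 0 := by
    rcases div_eq_zero_iff.1 hloc with h | h
    · exact neg_eq_zero.1 h
    · have := hypos z hz0 hz.1 (hz.2.trans he1.le)
      exact absurd h (by positivity)
  obtain ⟨η, hη, hηneg⟩ := (mem_nhdsGE_iff_exists_Ico_subset' hze).1
    (mem_nhdsWithin_of_mem_nhds
      ((hp.hasDerivAt z (hin z hz).2).continuousAt.eventually (gt_mem_nhds hpz)))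
  obtain ⟨t, htz, htlt⟩ := exists_between (lt_min (mem_Ioi.1 hη) hze)
  have hte : t < e := htlt.trans_le (min_le_right _ _)
  have hmem : ∀ s ∈ Icc z t, s ∈ Icc r₀ e := fun s hs => ⟨hzr.le.trans hs.1, hs.2.trans hte.le⟩
  have hneg : ∀ s ∈ Icc z t, p s < 0 := fun s hs =>
    hηneg ⟨hs.1, hs.2.trans_lt (htlt.trans_le (min_le_left _ _))⟩
  have hdW : ∀ s ∈ Icc z t, HasDerivAt _ _ s := fun s hs =>
    hasDerivAt_wronskian (hin s (hmem s hs)).1.ne' (hp.hasDerivAt s (hin s (hmem s hs)).2)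
      (hp.hasDerivAt' s (hin s (hmem s hs)).2) (hy s (hin s (hmem s hs)).1)
      (hy' s (hin s (hmem s hs)).1)
  have hmono : StrictMonoOn (fun s => s ^ 5 * (p s * (-3 * (s ^ 3)⁻¹ + 15 / 8 * (s ^ 5)⁻¹) -
      p' s * (3 / 2 * (s ^ 2)⁻¹ - 1 - 15 / 32 * (s ^ 4)⁻¹))) (Icc z t) := by
    apply strictMonoOn_of_hasDerivWithinAt_pos (convex_Icc z t)
    · exact fun s hs => (hdW s hs).continuousAt.continuousWithinAt
    · exact fun s hs => (hdW s (interior_subset hs)).hasDerivWithinAt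
    · intro s hs
      have hs := interior_subset hs
      obtain ⟨hs0, hs1⟩ := hin s (hmem s hs)
      have h1 := hpos s hs1
      have h2 := hle s hs1
      have h3 := hypos s hs0 (hmem s hs).1 hs1.2.le
      -- The constant `64` is `2 * 32`: the potential satisfies `2 u + lam ≤ 2 lam < 64`.
      have h4 : 64 * (3 / 2 * (s ^ 2)⁻¹ - 1 - 15 / 32 * (s ^ 4)⁻¹) ≤ 6 * (s ^ 4)⁻¹ := by
        rw [← sub_nonneg, show 6 * (s ^ 4)⁻¹ - 64 * (3 / 2 * (s ^ 2)⁻¹ - 1 - 15 / 32 * (s ^ 4)⁻¹) =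
          (8 * s ^ 2 - 6) ^ 2 * (s ^ 4)⁻¹ by field_simp; ring]
        positivity
      have h5 : (2 * |u s| + lam) * (3 / 2 * (s ^ 2)⁻¹ - 1 - 15 / 32 * (s ^ 4)⁻¹) <
          6 * (s ^ 4)⁻¹ := by
        refine (mul_lt_mul_of_pos_right ?_ h3).trans_le h4
        rw [abs_of_pos h1]
        linarith
      refine mul_pos (pow_pos hs0 5) ?_
      have := mul_pos_of_neg_of_neg (hneg s hs) (sub_neg.2 h5)
      linarith
  have hq : StrictAntiOn (fun s => p s / (3 / 2 * (s ^ 2)⁻¹ - 1 - 15 / 32 * (s ^ 4)⁻¹))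
      (Icc z t) := by
    apply strictAntiOn_of_hasDerivWithinAt_neg (convex_Icc z t)
    · exact fun s hs => (hdq s (hmem s hs)).continuousAt.continuousWithinAt
    · exact fun s hs => (hdq s (hmem s (interior_subset hs))).hasDerivWithinAt
    · intro s hs
      have hs' := interior_subset hs
      rw [interior_Icc] at hs
      have h1 := hypos s (hin s (hmem s hs')).1 (hmem s hs').1 (hin s (hmem s hs')).2.2.le
      have h2 := hmono ⟨le_rfl, htz.le⟩ hs' hs.1
      simp only [hWz] at h2
      exact div_neg_of_neg_of_pos (neg_neg_of_pos h2)
        (mul_pos (pow_pos (hin s (hmem s hs')).1 5) (pow_pos h1 2))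
  exact (hq ⟨le_rfl, htz.le⟩ ⟨htz.le, le_rfl⟩ htz).not_ge (hzmin (hmem t ⟨htz.le, le_rfl⟩))

/-- Testing with `u`: a solution of the linearized equation which is positive on the boundary
is not nonnegative. -/
lemma not_linearized_nonneg
    (hu : IsRadialSolution (emdenTerm lam u) u u' (lam / 2) 0)
    (hb : Tendsto u' (𝓝[<] 1) (𝓝 b)) (hb0 : b < 0) (hpos : ∀ r ∈ Ioo (0 : ℝ) 1, 0 < u r)
    (hp : IsRadialSolution (fun r => (2 * |u r| + lam) * p r) p p' a c) (hc : 0 < c) : ¬ ∀ r ∈ Ioo (0 : ℝ) 1, 0 ≤ p r := by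
  intro hnn
  obtain ⟨K, hK⟩ := hu.exists_linearized_bound
  obtain ⟨M, hM⟩ := hp.exists_abs_le
  obtain ⟨L, hL⟩ := hp.exists_tendsto_one' (K := K * M) fun r hr => by
    rw [abs_mul]
    exact mul_le_mul (hK r hr) (hM r hr) (abs_nonneg _) ((abs_nonneg _).trans (hK r hr))
  -- Lagrange's identity leaves the integrand `r⁵ u² p ≥ 0`, while the boundary term is `b * c < 0`.
  have h := le_of_hasDerivAt_nonneg
    (fun r hr => (hasDerivAt_wronskian hr.1.ne' (hu.hasDerivAt r hr) (hu.hasDerivAt' r hr)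
      (hp.hasDerivAt r hr) (hp.hasDerivAt' r hr)).neg) (fun r hr => ?_)
    (tendsto_wronskian hu.tendsto_zero hu.tendsto_zero' hp.tendsto_zero hp.tendsto_zero').neg
    (tendsto_wronskian hu.tendsto_one hb hp.tendsto_one hL).neg (1 / 2) (by norm_num)
  · have h1 := h.1.trans h.2
    simp only [one_pow, one_mul, zero_mul, zero_sub, neg_neg, ne_eq, OfNat.ofNat_ne_zero,
      not_false_eq_true, zero_pow, neg_zero] at h1
    exact (mul_neg_of_neg_of_pos hb0 hc).not_ge h1
  · have h1 := hpos r hr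
    rw [emdenTerm, abs_of_pos h1, ← mul_neg]
    refine mul_nonneg (pow_pos hr.1 5).le ?_
    have := mul_nonneg (mul_pos h1 h1).le (hnn r hr)
    linarith

/-- A solution of the linearized equation at a positive solution that is positive on the boundary
is not positive at the centre. -/
lemma center_nonpos_of_boundary_pos (hlam : 0 < lam)
    (hu : IsRadialSolution (emdenTerm lam u) u u' (lam / 2) 0)
    (hb : Tendsto u' (𝓝[<] 1) (𝓝 b)) (hnn : ∀ r ∈ Ioo (0 : ℝ) 1, 0 ≤ u r)
    (hp : IsRadialSolution (fun r => (2 * |u r| + lam) * p r) p p' a c) (hc : 0 < c) : a ≤ 0 := by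
  by_contra! ha
  have hpos : ∀ r ∈ Ioo (0 : ℝ) 1, 0 < u r := fun r hr => hu.pos_of_nonneg hlam hb hnn hr
  have hle : ∀ r ∈ Ioo (0 : ℝ) 1, u r ≤ lam / 2 := fun r hr =>
    hu.le_center_of_nonneg hlam hb hnn hr
  have h2 : (0 : ℝ) < √2 := by positivity
  have hsq : √2 ^ 2 = (2 : ℝ) := Real.sq_sqrt (by norm_num)
  have hinner : ∀ r, 0 < r → r < (√2)⁻¹ → 0 < p r := fun r h0 h1 =>
    hu.linearized_pos_of_center_pos hpos hle hp ha h0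
      (by rwa [mul_comm, ← lt_inv_mul_iff₀' h2, mul_one])
  have hr1 : (√2)⁻¹ < 1 := inv_lt_one_of_one_lt₀ (by rw [Real.lt_sqrt] <;> norm_num)
  have hr0 : (0 : ℝ) < (√2)⁻¹ := inv_pos.2 h2
  have hmid : 0 ≤ p (√2)⁻¹ := by
    have ht : Tendsto p (𝓝[<] (√2)⁻¹) (𝓝 (p (√2)⁻¹)) :=
      (hp.hasDerivAt _ ⟨hr0, hr1⟩).continuousAt.tendsto.mono_left nhdsWithin_le_nhds
    refine ge_of_tendsto ht ?_
    filter_upwards [Ioo_mem_nhdsLT hr0] with s hs using (hinner s hs.1 hs.2).le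
  refine hu.not_linearized_nonneg hb (hu.normalDeriv_neg hlam hb hnn) hpos hp hc fun r hr => ?_
  rcases lt_trichotomy r (√2)⁻¹ with h | h | h
  · exact (hinner r hr.1 h).le
  · rwa [h]
  · exact hp.linearized_nonneg_of_annulus (hu.lam_lt hlam hb hnn) hpos hle hc hr0
      (by rw [inv_pow, hsq, one_div]) hmid ⟨h, hr.2⟩

end IsRadialSolution

/-! ### Transfer from the ball to profiles, and conclusion. -/

lemma IsC2Dirichlet.isRadialSolution_profile {f : R6 → ℝ} {F : ℝ → ℝ} (hf : IsC2Dirichlet f)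
    (hr : IsRadialOnBall f)
    (hF : ∀ r ∈ Ioo (0 : ℝ) 1, -Laplacian.laplacian f (r • axisVector) = F r) :
    IsRadialSolution F (profile f) (profileDeriv f) (f 0) 0 where
  hasDerivAt r hr' := hf.hasDerivAt_profile (by rw [abs_of_pos hr'.1]; exact hr'.2)
  hasDerivAt' r hr' := by
    rw [← hF r hr', sub_neg_eq_add]
    exact hf.hasDerivAt_profileDeriv hr hr'.1 hr'.2
  tendsto_zero := hf.tendsto_profile_zero
  tendsto_zero' := hf.tendsto_profileDeriv_zero hr
  tendsto_one := hf.tendsto_profile_one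

lemma smul_axisVector_mem_ball_of_mem_Ioo {r : ℝ} (hr : r ∈ Ioo (0 : ℝ) 1) :
    r • axisVector ∈ ball (0 : R6) 1 :=
  smul_axisVector_mem_ball.2 (by rw [abs_of_pos hr.1]; exact hr.2)

/-- A function with a single nodal zone which is positive at the centre is nonnegative. -/
lemma nonneg_of_encard_nodalZones_eq_one {u : R6 → ℝ} (hu : ContinuousOn u (ball 0 1))
    (h0 : 0 < u 0) (h : (nodalZones u).encard = 1) : ∀ x ∈ ball (0 : R6) 1, 0 ≤ u x := by
  intro x hx
  by_contra! hneg
  set S : Set R6 := {y ∈ ball (0 : R6) 1 | u y ≠ 0} with hS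
  have h0S : (0 : R6) ∈ S := ⟨by simp, h0.ne'⟩
  have hxS : x ∈ S := ⟨hx, hneg.ne⟩
  obtain ⟨C, hC⟩ := encard_eq_one.1 h
  have e0 : connectedComponentIn S 0 ∈ nodalZones u := ⟨0, h0S, rfl⟩
  have ex : connectedComponentIn S x ∈ nodalZones u := ⟨x, hxS, rfl⟩
  rw [hC, mem_singleton_iff] at e0 ex
  have hxC : x ∈ connectedComponentIn S 0 := by
    rw [e0, ← ex]
    exact mem_connectedComponentIn hxS
  have hsub := connectedComponentIn_subset S 0
  -- A single zone would contain points of both signs, hence a zero of `u`.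
  obtain ⟨y, hy, hy0⟩ := isPreconnected_connectedComponentIn.intermediate_value hxC
    (mem_connectedComponentIn h0S) (hu.mono (hsub.trans (sep_subset _ _))) ⟨hneg.le, h0.le⟩
  exact (hsub hy).2 hy0

theorem mainTheorem6 (m : ℕ) (hm : 2 ≤ m) (lam : ℝ) (hlam : 0 < lam) (u v₀ : R6 → ℝ)
    (hu : IsLimitProfile lam (m - 1) u) (hnd : IsNondegenerate lam u)
    (hv : IsLinearizedSolution lam u v₀) :
    1 - 2 * v₀ 0 ≠ 0 ∧ (m = 2 → 0 < 1 - 2 * v₀ 0) := by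
  have hU : IsRadialSolution (emdenTerm lam (profile u)) (profile u) (profileDeriv u)
      (lam / 2) 0 := by
    rw [← hu.value_zero]
    exact hu.classical.isRadialSolution_profile hu.radial fun r hr =>
      hu.equation _ (smul_axisVector_mem_ball_of_mem_Ioo hr)
  have hV : IsRadialSolution (fun r => (2 * |profile u r| + lam) * profile v₀ r + profile u r)
      (profile v₀) (profileDeriv v₀) (v₀ 0) 0 :=
    hv.classical.isRadialSolution_profile (hv.isRadialOnBall hu.radial hnd) fun r hr => by
      have := hv.equation _ (smul_axisVector_mem_ball_of_mem_Ioo hr)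
      simp only [profile]
      linarith
  obtain ⟨b, hb⟩ := hU.exists_tendsto_one'_emden
  have hb0 := hU.normalDeriv_ne_zero hlam hb
  have hP := hU.sub_dilation hlam hb hV
  have hne : v₀ 0 - 1 / 2 ≠ 0 := by
    intro h
    rw [h] at hP
    obtain ⟨K, hK⟩ := hU.exists_linearized_bound
    have hz := hP.eq_zero_of_center hK
    have h1 : -b / (2 * lam) = 0 := tendsto_nhds_unique hP.tendsto_one
      (tendsto_const_nhds.congr' (by
        filter_upwards [Ioo_mem_nhdsLT (zero_lt_one (α := ℝ))] with r hr using (hz r hr).symm))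
    rw [div_eq_zero_iff] at h1
    rcases h1 with h1 | h1
    · exact hb0 (neg_eq_zero.1 h1)
    · linarith
  refine ⟨fun h => hne (by linarith), fun h2 => ?_⟩
  subst h2
  have hnn : ∀ r ∈ Ioo (0 : ℝ) 1, 0 ≤ profile u r := fun r hr =>
    nonneg_of_encard_nodalZones_eq_one hu.classical.contDiffOn.continuousOn
      (by rw [hu.value_zero]; positivity) (by simpa using hu.nodal) _
      (smul_axisVector_mem_ball_of_mem_Ioo hr)
  have hle := hU.center_nonpos_of_boundary_pos hlam hb hnn hP
    (div_pos (neg_pos.2 (hU.normalDeriv_neg hlam hb hnn)) (by positivity))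
  have := lt_of_le_of_ne hle hne
  linarith
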